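/- Let $\mathbb{F}_q$ be a finite field with $q$ elements, and let $\mathcal{C}$ be the finite set of $\mathbb{F}_q$-isomorphism classes of elliptic curves over $\mathbb{F}_q$, on which we put the measure with $$\mathbb{P}_q(\{E\}) = \frac{1}{q\,\#\mathrm{Aut}_{\mathbb{F}_q}(E)}.$$ For $E\in\mathcal{C}$ let $t_E = q+1-\#E(\mathbb{F}_q)$ be its trace of Frobenius. For a finite abelian group $A$ and $t\in\mathbb{Z}$ let $\mathcal{C}(A,t)$ be the set of $E\in\mathcal{C}$ such that $t_E=t$ and $A$ is isomorphic to a subgroup of $E(\mathbb{F}_q)$. Put $A_{m,n}=\mathbb{Z}/m\mathbb{Z}\times\mathbb{Z}/n\mathbb{Z}$. Let $n_1,n_2$ be positive integers with $n_2\mid n_1$, and let $t\in\mathbb{Z}$. We use the following notation, in which $\ell$ always denotes a prime and $v_\ell$ the $\ell$-adic valuation. * $D(t;n)=1$ if $n\mid q+1-t$, and $D(t;n)=0$ otherwise. * $d\,\|\,n_1$ means that $d$ is a positive integer with $v_\ell(d)=v_\ell(n_1)$ for every prime $\ell\mid d$. * $e\prec d$ means that $e$ is a positive integer with exactly the same prime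 divisors as $d$, and $v_\ell(e)\le v_\ell(n_1/n_2)-1$ for every prime $\ell\mid d$. * $\lambda(d)=(-1)^{\omega(d)}$, where $\omega(d)$ is the number of distinct prime factors of $d$. * For a positive integer $e$, $$D_{n_1,e}(t)=\prod_{\ell\mid n_1,\ \ell\mid e}\Big(D\big(t;\ell^{v_\ell(n_1n_2e)-1}\big)-D\big(t;\ell^{v_\ell(n_1n_2e)}\big)\Big)\ \prod_{\ell\mid n_1,\ \ell\nmid e}D\big(t;\ell^{v_\ell(n_1n_2)}\big).$$ Then $$\mathbb{P}_q\big(\mathcal{C}(A_{n_1,n_2},t)\big)=\mathbb{P}_q\big(\mathcal{C}(A_{n_2,n_2},t)\big)\,D(t;n_1n_2)+\sum_{\substack{d\,\|\,n_1\\ d\ge 2}}\ \sum_{e\prec d}\lambda(d)\,\mathbb{P}_q\big(\mathcal{C}(A_{n_2e,n_2e},t)\big)\,D_{n_1,e}(t).$$ -/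

import Mathlib

open scoped BigOperators

noncomputable section

namespace CurveCount

/-! ### Elliptic curves over a finite field, up to isomorphism -/

/-- Elliptic curves over `F`, given by nonsingular Weierstrass equations. -/
abbrev EllCurve (F : Type*) [Field F] : Type _ :=
  {W : WeierstrassCurve F // W.IsElliptic}

/-- Two elliptic curves over `F` are `F`-isomorphic when some admissible change of variables
`(x, y) ↦ (u²x + r, u³y + u²sx + t)` defined over `F` takes one to the other. -/
def isoSetoid (F : Type*) [Field F] : Setoid (EllCurve F) :=
  (MulAction.orbitRel (WeierstrassCurve.VariableChange F) (WeierstrassCurve F)).comap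
    Subtype.val

/-- The set of `F`-isomorphism classes of elliptic curves over `F`. -/
abbrev IsoClass (F : Type*) [Field F] : Type _ := Quotient (isoSetoid F)

instance finite_isoClass (F : Type*) [Field F] [Finite F] : Finite (IsoClass F) := by
  have : Finite (WeierstrassCurve F) :=
    Finite.of_injective
      (fun W : WeierstrassCurve F => (W.a₁, W.a₂, W.a₃, W.a₄, W.a₆)) (by
        intro W W' h
        simp only [Prod.mk.injEq] at h
        exact WeierstrassCurve.ext h.1 h.2.1 h.2.2.1 h.2.2.2.1 h.2.2.2.2)
  infer_instance

instance fintype_isoClass (F : Type*) [Field F] [Finite F] : Fintype (IsoClass F) :=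
  Fintype.ofFinite _

/-- A Weierstrass equation in the isomorphism class `c`. The quantities below (automorphism
group, group of rational points, trace) are isomorphism invariants, so that the choice
is irrelevant. -/
def model {F : Type*} [Field F] (c : IsoClass F) : WeierstrassCurve F := (Quotient.out c).1

/-- `#Aut_F(E)`: the `F`-automorphisms of `E` are the admissible changes of variables over `F`
that fix its Weierstrass equation. -/
def autCard {F : Type*} [Field F] (c : IsoClass F) : ℕ :=
  Nat.card (MulAction.stabilizer (WeierstrassCurve.VariableChange F) (model c))

/-- The trace of Frobenius `t_E = q + 1 - #E(F)`, where `q = #F`. -/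
def trace {F : Type*} [Field F] (c : IsoClass F) : ℤ :=
  (Nat.card F : ℤ) + 1 - (Nat.card (model c).toAffine.Point : ℤ)

/-- `A ↪ E(F)`: there is an injective group homomorphism from `A` to the group of `F`-points. -/
def Embeds {F : Type*} [Field F] [DecidableEq F] (A : Type*) [AddCommGroup A]
    (c : IsoClass F) : Prop :=
  ∃ f : A →+ (model c).toAffine.Point, Function.Injective f

/-- The set `𝓒(A, t)` of isomorphism classes of `E` over `F` with `A ↪ E(F)` and `t_E = t`. -/
def curves (F : Type*) [Field F] [DecidableEq F] (A : Type*) [AddCommGroup A] (t : ℤ) :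
    Set (IsoClass F) :=
  {c | Embeds A c ∧ trace c = t}

open Classical in
/-- The probability measure on the set of isomorphism classes, in which `{E}` has
probability `1 / (q · #Aut_F(E))`. -/
def prob {F : Type*} [Field F] [Finite F] (S : Set (IsoClass F)) : ℝ :=
  ∑ c : IsoClass F, if c ∈ S then 1 / ((Nat.card F : ℝ) * (autCard c : ℝ)) else 0

/-- `P_q(𝓒(A_{n₁,n₂}, t))` with `A_{n₁,n₂} = ℤ/n₁ × ℤ/n₂`. -/
def probCurves (F : Type*) [Field F] [Finite F] [DecidableEq F] (n₁ n₂ : ℕ) (t : ℤ) : ℝ :=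
  prob (curves F (ZMod n₁ × ZMod n₂) t)

/-! ### The arithmetic functions -/

/-- `D(t; n)` with `d = 1`: the indicator of `n ∣ q + 1 - t`. -/
def D (q : ℕ) (t : ℤ) (n : ℕ) : ℝ := if (n : ℤ) ∣ (q : ℤ) + 1 - t then 1 else 0

/-- `D_{ν,μ}(t)`, depending also on `q, n₁, n₂`: a product over the primes `ℓ ∣ ν`, in which
a prime `ℓ ∣ μ` contributes the indicator of `v_ℓ(q + 1 - t) = v_ℓ(n₁n₂μ) - 1`, and a prime
`ℓ ∤ μ` contributes the indicator of `v_ℓ(q + 1 - t) ≥ v_ℓ(n₁n₂)`. -/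
def DD (q n₁ n₂ : ℕ) (t : ℤ) (ν μ : ℕ) : ℝ :=
  ∏ ℓ ∈ ν.primeFactors,
    if ℓ ∣ μ then
      D q t (ℓ ^ ((n₁ * n₂ * μ).factorization ℓ - 1)) - D q t (ℓ ^ (n₁ * n₂ * μ).factorization ℓ)
    else D q t (ℓ ^ (n₁ * n₂).factorization ℓ)

/-- `ν ‖ n`: `ν` is a full divisor of `n`. -/
def IsFullDivisor (ν n : ℕ) : Prop :=
  0 < ν ∧ ∀ ℓ : ℕ, ℓ.Prime → ℓ ∣ ν → ν.factorization ℓ = n.factorization ℓ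

/-- `μ ≺ ν`, depending also on `n₁, n₂`: `μ` has the same prime divisors as `ν`, and
`v_ℓ(μ) ≤ v_ℓ(n₁/n₂) - 1` for each prime `ℓ ∣ ν`. -/
def Prec (n₁ n₂ μ ν : ℕ) : Prop :=
  0 < μ ∧ (∀ ℓ : ℕ, ℓ.Prime → (ℓ ∣ μ ↔ ℓ ∣ ν)) ∧
    ∀ ℓ : ℕ, ℓ.Prime → ℓ ∣ ν → μ.factorization ℓ + 1 ≤ (n₁ / n₂).factorization ℓ

/-- `λ(n) = (-1)^{ω(n)}`, with `ω(n)` the number of distinct prime factors of `n`. -/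
def lam (n : ℕ) : ℝ := (-1) ^ n.primeFactors.card

theorem IsFullDivisor.dvd {ν n : ℕ} (h : IsFullDivisor ν n) (hn : n ≠ 0) : ν ∣ n := by
  rw [← Nat.factorization_le_iff_dvd h.1.ne' hn]
  intro ℓ
  by_cases hℓ : ℓ.Prime ∧ ℓ ∣ ν
  · exact (h.2 ℓ hℓ.1 hℓ.2).le
  · have : ν.factorization ℓ = 0 := by
      rw [Nat.factorization_eq_zero_iff]
      tauto
    omega

theorem Prec.dvd {n₁ n₂ μ ν : ℕ} (h : Prec n₁ n₂ μ ν) (hn : n₁ ≠ 0) (hd : n₂ ∣ n₁) :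
    μ ∣ n₁ := by
  obtain ⟨m, rfl⟩ := hd
  have h2 : 0 < n₂ := Nat.pos_of_ne_zero (by rintro rfl; simp at hn)
  have hm : m ≠ 0 := by rintro rfl; simp at hn
  refine Dvd.dvd.mul_left ?_ n₂
  rw [← Nat.factorization_le_iff_dvd h.1.ne' hm]
  intro ℓ
  by_cases hℓ : ℓ.Prime ∧ ℓ ∣ μ
  · have := h.2.2 ℓ hℓ.1 ((h.2.1 ℓ hℓ.1).1 hℓ.2)
    rw [Nat.mul_div_cancel_left m h2] at this
    omega
  · have : μ.factorization ℓ = 0 := by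
      rw [Nat.factorization_eq_zero_iff]
      tauto
    omega

open Classical in
/-- The finite set of all full divisors `d ≥ 2` of `n` (every full divisor of `n` divides `n`). -/
def fullDivisors (n : ℕ) : Finset ℕ :=
  n.divisors.filter fun d => IsFullDivisor d n ∧ 2 ≤ d

open Classical in
/-- The finite set of all `e` with `e ≺ d` (every such `e` divides `n₁`). -/
def precSet (n₁ n₂ d : ℕ) : Finset ℕ := n₁.divisors.filter fun e => Prec n₁ n₂ e d

theorem mem_fullDivisors {n d : ℕ} (hn : n ≠ 0) :
    d ∈ fullDivisors n ↔ IsFullDivisor d n ∧ 2 ≤ d := by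
  simp only [fullDivisors, Finset.mem_filter, Nat.mem_divisors]
  exact ⟨fun h => h.2, fun h => ⟨⟨h.1.dvd hn, hn⟩, h⟩⟩

theorem mem_precSet {n₁ n₂ d e : ℕ} (hn : n₁ ≠ 0) (hd : n₂ ∣ n₁) :
    e ∈ precSet n₁ n₂ d ↔ Prec n₁ n₂ e d := by
  simp only [precSet, Finset.mem_filter, Nat.mem_divisors]
  exact ⟨fun h => h.2, fun h => ⟨⟨h.dvd hn hd, hn⟩, h⟩⟩

end CurveCount

end

/-!
The identity is linear in the measure, so it suffices to prove it for the indicator functions at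
each curve `E` of trace `t`. This is a statement about the finite abelian group `G = E(F)` of order
`q + 1 - t`, and it depends on `G` being of the form `ℤ/r × ℤ/s` with `s ∣ r`.

That form is read off from the torsion: `AddCommGroup.exists_equiv_zmod_prod_zmod` needs only
`#G[ℓ] ≤ ℓ ^ 2` for all primes `ℓ`, the characteristic included. For odd `ℓ` the `x`-coordinates of
the nonzero `ℓ`-torsion points are roots of the division polynomial `preΨ' ℓ`, which has degree at
most `(ℓ ^ 2 - 1) / 2`; for `ℓ = 2` they are roots of the cubic `Ψ₂Sq`. To see that `preΨ' ℓ`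
vanishes there, one attaches to a point `P` a sequence `w` with
`w (k + 1) * w (k - 1) = (x(P) - x(kP)) * w k ^ 2`, which vanishes first at the order of `P`. The
roots in `t` of a symmetric form in `t`, `x(P)`, `x(Q)` are `x(P + Q)` and `x(P - Q)`, and this
symmetry alone yields
`w (m + n) * w (m - n) = (x(nP) - x(mP)) * w m ^ 2 * w n ^ 2`
(`ellSeq_add_mul_ellSeq_sub`), hence the recurrences that define the division polynomials
(`ellSeq_eq_eval_preΨ'`). Finally `preΨ' ℓ` is not the zero polynomial, even when `ℓ` is the
characteristic, because it is coprime to `Ψ₂Sq`: modulo `Ψ₂Sq` it is up to sign a power of `Ψ₃`,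
and `Δ` is a combination of `Ψ₃` and `Ψ₂Sq`.

For `G = ℤ/r × ℤ/s` the group `ℤ/n₁ × ℤ/n₂` embeds exactly when `n₁ ∣ r` and `n₂ ∣ s`. Given
`n₂ ∣ s` and `n₁ n₂ ∣ r s`, call a prime `ℓ ∣ n₁` bad if `v(r) < v(n₁)`. For fixed `d` the factor
`D_{n₁,e}` leaves at most one `e ≺ d`, and the condition `n₂ e ∣ s` on it says that all primes
dividing `d` are bad (`sum_precSet`). The sum over `d` is then the alternating sum over the nonempty
sets of bad primes, which is `-1` if there is a bad prime and `0` otherwise.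
-/

/-! ### The `x`-coordinate of sums and differences of points -/

namespace WeierstrassCurve

section BiquadraticForm

variable {R : Type*} [CommRing R] (W : WeierstrassCurve R)

/-- The symmetric form, of degree two in each variable, whose roots in the first variable are
`x(P + Q)` and `x(P - Q)` when the other two are `x(P)` and `x(Q)`. -/
def xForm (t u v : R) : R :=
  t ^ 2 * (u - v) ^ 2 -
    t * (2 * u * v * (u + v) + W.b₂ * u * v + W.b₄ * (u + v) + W.b₆) +
    (u ^ 2 * v ^ 2 - W.b₄ * u * v - W.b₆ * (u + v) - W.b₈)

lemma xForm_rotate (t u v : R) : W.xForm t u v = W.xForm v t u := by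
  simp only [xForm]; ring

end BiquadraticForm

namespace Affine.Point

variable {K : Type*} [Field K] {W : WeierstrassCurve K}

/-- The `x`-coordinate of a point; its value `1` at the point at infinity is a junk value. -/
noncomputable def xCoord (P : W.toAffine.Point) : K := P.xRep 0

/-- The value at a point of the `2`-division polynomial `2y + a₁x + a₃`; its value `0` at the point
at infinity is a junk value. -/
noncomputable def psiTwo : W.toAffine.Point → K
  | 0 => 0
  | some x y _ => 2 * y + W.a₁ * x + W.a₃

lemma xCoord_eq_iff {P Q : W.toAffine.Point} (hP : P ≠ 0) (hQ : Q ≠ 0) :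
    P.xCoord = Q.xCoord ↔ P = Q ∨ P = -Q := by
  match P, Q with
  | 0, _ => exact absurd rfl hP
  | some .., 0 => exact absurd rfl hQ
  | some .., some .. => simp only [xCoord, xRep_some, Matrix.cons_val_zero]; exact X_eq_iff

lemma psiTwo_sq {P : W.toAffine.Point} (hP : P ≠ 0) :
    P.psiTwo ^ 2 = W.Ψ₂Sq.eval P.xCoord := by
  match P with
  | 0 => exact absurd rfl hP
  | some x y h =>
    have e := (W.toAffine.equation_iff x y).1 h.1
    simp only [psiTwo, xCoord, xRep_some, Matrix.cons_val_zero, Ψ₂Sq, b₂, b₄, b₆, Polynomial.eval_add,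
      Polynomial.eval_mul, Polynomial.eval_C, Polynomial.eval_pow, Polynomial.eval_X]
    linear_combination 4 * e

variable [DecidableEq K]

/-- The sum and the product of `x(P + Q)` and `x(P - Q)` are rational functions of `x(P)` and `x(Q)`,
stated as the factorization of `xForm` in its first variable. -/
lemma sub_xCoord_add_mul_sub_xCoord_sub {P Q : W.toAffine.Point} (hP : P ≠ 0) (hQ : Q ≠ 0)
    (hPQ : P.xCoord ≠ Q.xCoord) (t : K) :
    (t - (P + Q).xCoord) * (t - (P - Q).xCoord) * (P.xCoord - Q.xCoord) ^ 2 =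
      W.xForm t P.xCoord Q.xCoord := by
  match P, Q with
  | 0, _ => exact absurd rfl hP
  | some .., 0 => exact absurd rfl hQ
  | some x₁ y₁ h₁, some x₂ y₂ h₂ =>
    simp only [xCoord, xRep_some, Matrix.cons_val_zero] at hPQ
    rw [sub_eq_add_neg (some x₁ y₁ h₁), neg_some, add_of_X_ne hPQ, add_of_X_ne hPQ]
    simp only [xCoord, xRep_some, Matrix.cons_val_zero, Affine.addX, Affine.slope_of_X_ne hPQ,
      Affine.negY]
    have hd : x₁ - x₂ ≠ 0 := sub_ne_zero.2 hPQ
    have e₁ := (W.toAffine.equation_iff x₁ y₁).1 h₁.1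
    have e₂ := (W.toAffine.equation_iff x₂ y₂).1 h₂.1
    obtain ⟨l, hl⟩ : ∃ l, l = (y₁ - y₂) / (x₁ - x₂) := ⟨_, rfl⟩
    obtain ⟨m, hm⟩ : ∃ m, m = (y₁ - (-y₂ - W.a₁ * x₂ - W.a₃)) / (x₁ - x₂) := ⟨_, rfl⟩
    rw [← hl, ← hm]
    rw [eq_div_iff hd] at hl hm
    -- On the curve the product of the two slopes has only a simple pole along `x₁ = x₂`.
    have hlm : l * m * (x₁ - x₂) =
        x₁ ^ 2 + x₁ * x₂ + x₂ ^ 2 + W.a₂ * (x₁ + x₂) + W.a₄ - W.a₁ * y₁ := by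
      apply mul_right_cancel₀ hd
      linear_combination (m * (x₁ - x₂)) * hl + (y₁ - y₂) * hm + e₁ - e₂
    have hsum : ((l ^ 2 + W.a₁ * l - W.a₂ - x₁ - x₂) + (m ^ 2 + W.a₁ * m - W.a₂ - x₁ - x₂)) *
        (x₁ - x₂) ^ 2 =
        2 * x₁ * x₂ * (x₁ + x₂) + W.b₂ * x₁ * x₂ + W.b₄ * (x₁ + x₂) + W.b₆ := by
      simp only [b₂, b₄, b₆]
      grind
    have hprod : ((l ^ 2 + W.a₁ * l - W.a₂ - x₁ - x₂) * (m ^ 2 + W.a₁ * m - W.a₂ - x₁ - x₂)) *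
        (x₁ - x₂) ^ 2 =
        x₁ ^ 2 * x₂ ^ 2 - W.b₄ * x₁ * x₂ - W.b₆ * (x₁ + x₂) - W.b₈ := by
      have expand : ((l ^ 2 + W.a₁ * l - W.a₂ - x₁ - x₂) * (m ^ 2 + W.a₁ * m - W.a₂ - x₁ - x₂)) *
          (x₁ - x₂) ^ 2 =
          (l * m * (x₁ - x₂)) ^ 2 +
            W.a₁ * (l * m * (x₁ - x₂)) * (l * (x₁ - x₂) + m * (x₁ - x₂)) +
            W.a₁ ^ 2 * (l * m * (x₁ - x₂)) * (x₁ - x₂) -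
            (W.a₂ + x₁ + x₂) * ((l * (x₁ - x₂)) ^ 2 + (m * (x₁ - x₂)) ^ 2) -
            (W.a₂ + x₁ + x₂) * W.a₁ * (x₁ - x₂) * (l * (x₁ - x₂) + m * (x₁ - x₂)) +
            (W.a₂ + x₁ + x₂) ^ 2 * (x₁ - x₂) ^ 2 := by ring
      rw [expand, hlm, hl, hm]
      simp only [b₄, b₆, b₈]
      linear_combination (-W.a₁ ^ 2 - 2 * (W.a₂ + x₁ + x₂)) * e₁ - 2 * (W.a₂ + x₁ + x₂) * e₂
    simp only [xForm]
    linear_combination hprod - t * hsum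

lemma psiTwo_eq_zero_iff (P : W.toAffine.Point) : P.psiTwo = 0 ↔ (2 : ℕ) • P = 0 := by
  match P with
  | 0 => exact iff_of_true rfl (smul_zero _)
  | some x y h =>
    rw [two_nsmul, add_eq_zero_iff_eq_neg, neg_some, Point.some.injEq]
    simp only [psiTwo, Affine.negY, true_and]
    constructor <;> intro e <;> linear_combination e

lemma xCoord_sub_xCoord_two_nsmul {P : W.toAffine.Point} (hP : (2 : ℕ) • P ≠ 0) :
    (P.xCoord - ((2 : ℕ) • P).xCoord) * P.psiTwo ^ 2 = W.Ψ₃.eval P.xCoord := by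
  match P with
  | 0 => exact absurd (smul_zero _) hP
  | some x y h =>
    have hψ := mt (psiTwo_eq_zero_iff _).1 hP
    have e := (W.toAffine.equation_iff x y).1 h.1
    have hy : y ≠ W.toAffine.negY x y := by
      intro hy
      apply hψ
      simp only [psiTwo]
      simp only [Affine.negY] at hy
      linear_combination hy
    rw [two_nsmul, add_self_of_Y_ne hy]
    simp only [psiTwo] at hψ
    simp only [psiTwo, xCoord, xRep_some, Matrix.cons_val_zero, Affine.addX,
      Affine.slope_of_Y_ne rfl hy, Affine.negY, Ψ₃, b₂, b₄, b₆, b₈, Polynomial.eval_add,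
      Polynomial.eval_mul, Polynomial.eval_C, Polynomial.eval_pow, Polynomial.eval_X,
      Polynomial.eval_ofNat]
    have hd : y - (-y - W.a₁ * x - W.a₃) ≠ 0 := by
      rwa [show y - (-y - W.a₁ * x - W.a₃) = 2 * y + W.a₁ * x + W.a₃ by ring]
    obtain ⟨l, hl⟩ : ∃ l, l = (3 * x ^ 2 + 2 * W.a₂ * x + W.a₄ - W.a₁ * y) /
      (y - (-y - W.a₁ * x - W.a₃)) := ⟨_, rfl⟩
    rw [← hl]
    rw [eq_div_iff hd] at hl
    grind

end Affine.Point

end WeierstrassCurve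

/-! ### Division polynomials vanish at torsion points -/

namespace WeierstrassCurve.Affine.Point

variable {K : Type*} [Field K] {W : WeierstrassCurve K} [DecidableEq K] (P : W.toAffine.Point)

lemma nsmul_ne_zero_of_lt {n : ℕ} (hn : 0 < n) (h : n < addOrderOf P) : n • P ≠ 0 := fun h0 =>
  (Nat.le_of_dvd hn (addOrderOf_dvd_of_nsmul_eq_zero h0)).not_gt h

lemma xCoord_nsmul_ne {m n : ℕ} (hn : 0 < n) (hnm : n < m) (h : m + n < addOrderOf P) :
    (m • P).xCoord ≠ (n • P).xCoord := by
  rw [Ne, xCoord_eq_iff (P.nsmul_ne_zero_of_lt (by omega) (by omega))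
    (P.nsmul_ne_zero_of_lt hn (by omega)), not_or]
  constructor
  · rw [← sub_eq_zero, sub_eq_add_neg, ← sub_nsmul P hnm.le]
    exact P.nsmul_ne_zero_of_lt (by omega) (by omega)
  · rw [← add_eq_zero_iff_eq_neg, ← add_nsmul]
    exact P.nsmul_ne_zero_of_lt (by omega) (by omega)

/-- The elliptic divisibility sequence of a point `P`, defined from the `x`-coordinates of its
multiples by `w (k + 1) * w (k - 1) = (x(P) - x(kP)) * w k ^ 2`. It is meaningful only up to the
order of `P`, where it first vanishes; from there on it runs into divisions by zero. -/
noncomputable def ellSeq : ℕ → K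
  | 0 => 0
  | 1 => 1
  | 2 => P.psiTwo
  | n + 3 => (P.xCoord - ((n + 2) • P).xCoord) * ellSeq (n + 2) ^ 2 / ellSeq (n + 1)

lemma ellSeq_ne_zero {n : ℕ} (hn : 0 < n) (h : n < addOrderOf P) : P.ellSeq n ≠ 0 := by
  induction n using Nat.strong_induction_on with
  | _ n ih =>
    match n, hn with
    | 1, _ => simp [ellSeq]
    | 2, _ =>
      rw [ellSeq, Ne, psiTwo_eq_zero_iff]
      exact P.nsmul_ne_zero_of_lt two_pos h
    | n + 3, _ =>
      have h1 := ih (n + 1) (by omega) (by omega) (by omega)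
      have h2 := ih (n + 2) (by omega) (by omega) (by omega)
      have hx := P.xCoord_nsmul_ne one_pos (show 1 < n + 2 by omega) (by omega)
      rw [one_nsmul] at hx
      rw [ellSeq]
      exact div_ne_zero (mul_ne_zero (sub_ne_zero.2 hx.symm) (pow_ne_zero _ h2)) h1

lemma ellSeq_mul {k : ℕ} (h : k + 1 < addOrderOf P) :
    P.ellSeq (k + 2) * P.ellSeq k =
      (P.xCoord - ((k + 1) • P).xCoord) * P.ellSeq (k + 1) ^ 2 := by
  match k with
  | 0 => simp [ellSeq]
  | k + 1 => rw [ellSeq, div_mul_cancel₀ _ (P.ellSeq_ne_zero (by omega) (by omega))]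

lemma ellSeq_addOrderOf (h : 3 ≤ addOrderOf P) : P.ellSeq (addOrderOf P) = 0 := by
  obtain ⟨k, hk⟩ := Nat.exists_eq_add_of_le' h
  have hmul := P.ellSeq_mul (k := k + 1) (by omega)
  have hx : ((k + 2) • P).xCoord = P.xCoord := by
    have h1 : P ≠ 0 := one_nsmul P ▸ P.nsmul_ne_zero_of_lt one_pos (by omega)
    rw [xCoord_eq_iff (P.nsmul_ne_zero_of_lt (by omega) (by omega)) h1]
    right
    rw [← add_eq_zero_iff_eq_neg, ← succ_nsmul, show k + 2 + 1 = addOrderOf P by omega,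
      addOrderOf_nsmul_eq_zero]
  rw [hx, sub_self, zero_mul] at hmul
  rw [hk]
  exact (mul_eq_zero.1 hmul).resolve_right (P.ellSeq_ne_zero (by omega) (by omega))

/-- The identity `σ(u + v) σ(u - v) = (℘(v) - ℘(u)) σ(u)² σ(v)²`. The induction on `n` uses only the
defining relation of the sequence, and the invariance under permutations of the form whose roots
are `x(P + Q)` and `x(P - Q)`. -/
lemma ellSeq_add_mul_ellSeq_sub {m n : ℕ} (hn : 0 < n) (hnm : n ≤ m) (h : m + n ≤ addOrderOf P)
    (h3 : 3 ≤ addOrderOf P) :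
    P.ellSeq (m + n) * P.ellSeq (m - n) =
      ((n • P).xCoord - (m • P).xCoord) * P.ellSeq m ^ 2 * P.ellSeq n ^ 2 := by
  have one_lt_form : ∀ {i : ℕ}, 1 < i → i + 1 < addOrderOf P → ∀ t : K,
      (t - ((i + 1) • P).xCoord) * (t - ((i - 1) • P).xCoord) *
        ((i • P).xCoord - P.xCoord) ^ 2 = W.xForm t (i • P).xCoord P.xCoord := by
    intro i hi hi' t
    have hx := P.xCoord_nsmul_ne one_pos hi hi'
    rw [one_nsmul] at hx
    have h1 : P ≠ 0 := one_nsmul P ▸ P.nsmul_ne_zero_of_lt one_pos (by omega)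
    rw [← sub_xCoord_add_mul_sub_xCoord_sub (P.nsmul_ne_zero_of_lt (by omega) (by omega)) h1 hx,
      succ_nsmul, sub_nsmul P hi.le, one_nsmul, ← sub_eq_add_neg]
  induction n using Nat.strong_induction_on with
  | _ n ih =>
    rcases hnm.eq_or_lt with rfl | hlt
    · simp [ellSeq]
    match n, hn with
    | 1, _ =>
      obtain ⟨k, rfl⟩ := Nat.exists_eq_add_of_le' hlt.le
      have := P.ellSeq_mul (k := k) (by omega)
      simpa [ellSeq] using this
    | 2, _ =>
      obtain ⟨k, rfl⟩ := Nat.exists_eq_add_of_le' hlt.le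
      have r₁ := P.ellSeq_mul (k := k + 2) (by omega)
      have r₂ := P.ellSeq_mul (k := k) (by omega)
      have r₃ := P.ellSeq_mul (k := k + 1) (by omega)
      have f := one_lt_form (i := k + 2) (by omega) (by omega) P.xCoord
      have hΨ := xCoord_sub_xCoord_two_nsmul (P.nsmul_ne_zero_of_lt two_pos (by omega))
      have hψ := psiTwo_sq (P := P) (by simpa using P.nsmul_ne_zero_of_lt one_pos (by omega))
      have hform : W.xForm P.xCoord ((k + 2) • P).xCoord P.xCoord =
          (((2 : ℕ) • P).xCoord - ((k + 2) • P).xCoord) * P.psiTwo ^ 2 := by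
        have e : W.xForm P.xCoord ((k + 2) • P).xCoord P.xCoord =
            (P.xCoord - ((k + 2) • P).xCoord) * W.Ψ₂Sq.eval P.xCoord - W.Ψ₃.eval P.xCoord := by
          simp only [xForm, Ψ₂Sq, Ψ₃, Polynomial.eval_add, Polynomial.eval_mul, Polynomial.eval_C,
            Polynomial.eval_pow, Polynomial.eval_X, Polynomial.eval_ofNat]
          ring
        rw [e, ← hΨ, ← hψ]
        ring
      rw [hform, show k + 2 - 1 = k + 1 by omega] at f
      have h0 := P.ellSeq_ne_zero (n := k + 2) (by omega) (by omega)
      simp only [ellSeq.eq_3, Nat.add_sub_cancel]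
      apply mul_right_cancel₀ (pow_ne_zero 2 h0)
      calc P.ellSeq (k + 2 + 2) * P.ellSeq k * P.ellSeq (k + 2) ^ 2
          = (P.ellSeq (k + 2 + 2) * P.ellSeq (k + 2)) * (P.ellSeq (k + 2) * P.ellSeq k) := by ring
        _ = (P.xCoord - ((k + 2 + 1) • P).xCoord) * (P.xCoord - ((k + 1) • P).xCoord) *
            (P.ellSeq (k + 1 + 2) * P.ellSeq (k + 1)) ^ 2 := by rw [r₁, r₂]; ring
        _ = ((P.xCoord - ((k + 2 + 1) • P).xCoord) * (P.xCoord - ((k + 1) • P).xCoord) *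
            (((k + 2) • P).xCoord - P.xCoord) ^ 2) * P.ellSeq (k + 2) ^ 4 := by rw [r₃]; ring
        _ = _ := by rw [f]; ring
    | n + 3, _ =>
      obtain ⟨k, rfl⟩ := Nat.exists_eq_add_of_le' hlt.le
      have ih₁ := ih (n + 2) (by omega) (by omega) (by omega) (by omega)
      have ih₂ := ih (n + 1) (by omega) (by omega) (by omega) (by omega)
      rw [show k + (n + 3) - (n + 2) = k + 1 by omega] at ih₁
      rw [show k + (n + 3) - (n + 1) = k + 2 by omega] at ih₂
      rw [show k + (n + 3) - (n + 3) = k by omega]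
      have r₁ := P.ellSeq_mul (k := k + (n + 3) + (n + 1)) (by omega)
      have r₂ := P.ellSeq_mul (k := k) (by omega)
      have r₃ := P.ellSeq_mul (k := n + 1) (by omega)
      have f₁ := sub_xCoord_add_mul_sub_xCoord_sub
        (P.nsmul_ne_zero_of_lt (n := k + (n + 3)) (by omega) (by omega))
        (P.nsmul_ne_zero_of_lt (n := n + 2) (by omega) (by omega))
        (P.xCoord_nsmul_ne (by omega) (by omega) (by omega)) P.xCoord
      rw [← add_nsmul, sub_eq_add_neg (_ • P), ← sub_nsmul P (by omega), show k + (n + 3) - (n + 2) = k + 1 by omega,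
        xForm_rotate, xForm_rotate] at f₁
      have f₂ := one_lt_form (i := n + 2) (by omega) (by omega) ((k + (n + 3)) • P).xCoord
      rw [show n + 2 - 1 = n + 1 by omega] at f₂
      have h1 := P.ellSeq_ne_zero (n := k + (n + 3) + (n + 1)) (by omega) (by omega)
      have h2 := P.ellSeq_ne_zero (n := k + 2) (by omega) (by omega)
      apply mul_right_cancel₀ (mul_ne_zero h1 h2)
      calc P.ellSeq (k + (n + 3) + (n + 3)) * P.ellSeq k *
            (P.ellSeq (k + (n + 3) + (n + 1)) * P.ellSeq (k + 2))
          = (P.ellSeq (k + (n + 3) + (n + 1) + 2) * P.ellSeq (k + (n + 3) + (n + 1))) *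
            (P.ellSeq (k + 2) * P.ellSeq k) := by
              rw [show k + (n + 3) + (n + 1) + 2 = k + (n + 3) + (n + 3) by omega]; ring
        _ = (P.xCoord - ((k + (n + 3) + (n + 2)) • P).xCoord) * (P.xCoord - ((k + 1) • P).xCoord) *
            (P.ellSeq (k + (n + 3) + (n + 2)) * P.ellSeq (k + 1)) ^ 2 := by
              rw [r₁, r₂, show k + (n + 3) + (n + 1) + 1 = k + (n + 3) + (n + 2) by omega]; ring
        _ = W.xForm ((k + (n + 3)) • P).xCoord ((n + 2) • P).xCoord P.xCoord *
            P.ellSeq (k + (n + 3)) ^ 4 * P.ellSeq (n + 2) ^ 4 := by rw [ih₁, ← f₁]; ring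
        _ = (((k + (n + 3)) • P).xCoord - ((n + 3) • P).xCoord) *
            (((k + (n + 3)) • P).xCoord - ((n + 1) • P).xCoord) * P.ellSeq (k + (n + 3)) ^ 4 *
            (P.ellSeq (n + 1 + 2) * P.ellSeq (n + 1)) ^ 2 := by rw [← f₂, r₃]; ring
        _ = _ := by
              rw [ih₂]; ring

/-- Up to the order of `P`, the sequence is given by the division polynomials: both satisfy the same
recurrences, which follow from `ellSeq_add_mul_ellSeq_sub` for `(m + 1, m)` and `(m + 1, m - 1)`. -/
lemma ellSeq_eq_eval_preΨ' (h3 : 3 ≤ addOrderOf P) {n : ℕ} (h : n ≤ addOrderOf P) :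
    P.ellSeq n = (W.preΨ' n).eval P.xCoord * if Even n then P.psiTwo else 1 := by
  have h1 : P ≠ 0 := one_nsmul P ▸ P.nsmul_ne_zero_of_lt one_pos (by omega)
  have hψ0 : P.psiTwo ≠ 0 := P.ellSeq_ne_zero two_pos (by omega)
  have hψ := psiTwo_sq h1
  have hΨ := xCoord_sub_xCoord_two_nsmul (P.nsmul_ne_zero_of_lt two_pos (by omega))
  have e3 : P.ellSeq 3 = W.Ψ₃.eval P.xCoord := by
    have := P.ellSeq_mul (k := 1) (by omega)
    rw [← hΨ]
    simpa only [ellSeq, mul_one] using this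
  have e4 (h4 : 4 ≤ addOrderOf P) : P.ellSeq 4 = W.preΨ₄.eval P.xCoord * P.psiTwo := by
    have r := P.ellSeq_mul (k := 2) (by omega)
    have hx := P.xCoord_nsmul_ne one_pos one_lt_two (by omega)
    rw [one_nsmul] at hx
    have f := sub_xCoord_add_mul_sub_xCoord_sub (P.nsmul_ne_zero_of_lt two_pos (by omega)) h1 hx
    have hsub : (2 : ℕ) • P - P = P := by rw [two_nsmul, add_sub_cancel_right]
    rw [← succ_nsmul, hsub] at f
    -- The coefficient of `t` in `f`, extracted in every characteristic.
    have f' := congrArg₂ (· - ·) (f 1) (f 0)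
    have hsum : (P.xCoord + ((3 : ℕ) • P).xCoord) * (((2 : ℕ) • P).xCoord - P.xCoord) ^ 2 =
        2 * ((2 : ℕ) • P).xCoord * P.xCoord * (((2 : ℕ) • P).xCoord + P.xCoord) +
          W.b₂ * ((2 : ℕ) • P).xCoord * P.xCoord + W.b₄ * (((2 : ℕ) • P).xCoord + P.xCoord) +
          W.b₆ := by
      simp only [xForm] at f'
      linear_combination -f'
    have r' : P.ellSeq 4 * P.psiTwo =
        (P.xCoord - ((3 : ℕ) • P).xCoord) * ((P.xCoord - ((2 : ℕ) • P).xCoord) * P.psiTwo ^ 2) ^ 2 := by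
      rw [hΨ, ← e3]; exact r
    apply mul_right_cancel₀ hψ0
    rw [r']
    have ha : ((2 : ℕ) • P).xCoord * P.psiTwo ^ 2 =
        P.xCoord * P.psiTwo ^ 2 - W.Ψ₃.eval P.xCoord := by linear_combination -hΨ
    calc _ = 2 * P.xCoord * (P.xCoord * P.psiTwo ^ 2 - ((2 : ℕ) • P).xCoord * P.psiTwo ^ 2) ^ 2 -
          (2 * (((2 : ℕ) • P).xCoord * P.psiTwo ^ 2) * P.xCoord *
              (((2 : ℕ) • P).xCoord * P.psiTwo ^ 2 + P.xCoord * P.psiTwo ^ 2) +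
            W.b₂ * (((2 : ℕ) • P).xCoord * P.psiTwo ^ 2) * P.xCoord * P.psiTwo ^ 2 +
            W.b₄ * (((2 : ℕ) • P).xCoord * P.psiTwo ^ 2 + P.xCoord * P.psiTwo ^ 2) *
              P.psiTwo ^ 2 +
            W.b₆ * (P.psiTwo ^ 2) ^ 2) := by linear_combination (-P.psiTwo ^ 4) * hsum
      _ = W.preΨ₄.eval P.xCoord * P.psiTwo ^ 2 := by
        rw [ha, hψ]
        simp only [Ψ₂Sq, Ψ₃, preΨ₄, Polynomial.eval_add, Polynomial.eval_mul, Polynomial.eval_C,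
          Polynomial.eval_pow, Polynomial.eval_X, Polynomial.eval_ofNat, b₂, b₄, b₆, b₈]
        ring
      _ = _ := by ring
  induction n using Nat.strong_induction_on with
  | _ n ih =>
    match n with
    | 0 => simp [ellSeq]
    | 1 => simp [ellSeq]
    | 2 => simp [ellSeq]
    | 3 => simp [e3, show ¬ Even 3 by decide]
    | 4 => simp [e4 h, show Even 4 by decide]
    | n + 5 =>
      obtain ⟨m, hm | hm⟩ := (n + 5).even_or_odd'
      · obtain ⟨m, rfl⟩ := Nat.exists_eq_add_of_le' (show 3 ≤ m by omega)
        have r₁ := P.ellSeq_mul (k := m + 3) (by omega)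
        have r₂ := P.ellSeq_mul (k := m + 1) (by omega)
        have hrec := P.ellSeq_add_mul_ellSeq_sub (m := m + 4) (n := m + 2) (by omega) (by omega)
          (by omega) h3
        rw [show m + 4 + (m + 2) = 2 * (m + 3) by omega, show m + 4 - (m + 2) = 2 by omega] at hrec
        replace hrec : P.ellSeq (2 * (m + 3)) * P.psiTwo =
            P.ellSeq (m + 5) * P.ellSeq (m + 3) * P.ellSeq (m + 2) ^ 2 -
              P.ellSeq (m + 3) * P.ellSeq (m + 1) * P.ellSeq (m + 4) ^ 2 := by
          rw [r₁, r₂]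
          simp only [ellSeq.eq_3] at hrec
          linear_combination hrec
        rw [ih (m + 1) (by omega) (by omega), ih (m + 2) (by omega) (by omega),
          ih (m + 3) (by omega) (by omega), ih (m + 4) (by omega) (by omega),
          ih (m + 5) (by omega) (by omega)] at hrec
        rw [hm, preΨ'_even, if_pos (even_two_mul _)]
        apply mul_right_cancel₀ hψ0
        rw [hrec]
        simp only [Polynomial.eval_sub, Polynomial.eval_mul, Polynomial.eval_pow]
        rcases m.even_or_odd with hm | hm <;> simp [hm, parity_simps] <;> ring
      · obtain ⟨m, rfl⟩ := Nat.exists_eq_add_of_le' (show 2 ≤ m by omega)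
        have r₁ := P.ellSeq_mul (k := m + 2) (by omega)
        have r₂ := P.ellSeq_mul (k := m + 1) (by omega)
        have hrec := P.ellSeq_add_mul_ellSeq_sub (m := m + 3) (n := m + 2) (by omega) (by omega)
          (by omega) h3
        rw [show m + 3 + (m + 2) = 2 * (m + 2) + 1 by omega,
          show m + 3 - (m + 2) = 1 by omega] at hrec
        replace hrec : P.ellSeq (2 * (m + 2) + 1) =
            P.ellSeq (m + 4) * P.ellSeq (m + 2) * P.ellSeq (m + 2) ^ 2 -
              P.ellSeq (m + 3) * P.ellSeq (m + 1) * P.ellSeq (m + 3) ^ 2 := by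
          rw [r₁, r₂]
          simp only [ellSeq.eq_2] at hrec
          linear_combination hrec
        rw [ih (m + 1) (by omega) (by omega), ih (m + 2) (by omega) (by omega),
          ih (m + 3) (by omega) (by omega), ih (m + 4) (by omega) (by omega)] at hrec
        rw [hm, hrec, preΨ'_odd, if_neg (Nat.not_even_two_mul_add_one _), mul_one]
        have hψ4 : P.psiTwo ^ 4 = (W.Ψ₂Sq.eval P.xCoord) ^ 2 := by rw [← hψ]; ring
        rcases m.even_or_odd with hm | hm
        · simp [hm, parity_simps]
          linear_combination ((W.preΨ' (m + 4)).eval P.xCoord *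
            (W.preΨ' (m + 2)).eval P.xCoord ^ 3) * hψ4
        · simp [Nat.not_even_iff_odd.2 hm, parity_simps]
          linear_combination (-(W.preΨ' (m + 1)).eval P.xCoord *
            (W.preΨ' (m + 3)).eval P.xCoord ^ 3) * hψ4

/-- The `x`-coordinates of points of odd order `n > 1` are roots of the `n`-division polynomial. -/
lemma eval_preΨ'_addOrderOf (h3 : 3 ≤ addOrderOf P) (hodd : Odd (addOrderOf P)) :
    (W.preΨ' (addOrderOf P)).eval P.xCoord = 0 := by
  have h := P.ellSeq_eq_eval_preΨ' h3 le_rfl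
  rwa [P.ellSeq_addOrderOf h3, if_neg (Nat.not_even_iff_odd.2 hodd), mul_one, eq_comm] at h

end WeierstrassCurve.Affine.Point

/-! ### Torsion of prime order -/

namespace WeierstrassCurve

open Polynomial

section Nonvanishing

variable {K : Type*} [Field K] (W : WeierstrassCurve K) [W.IsElliptic]

/-- An explicit Bézout identity expresses `Δ` through `Ψ₃` and `Ψ₂Sq`, in every characteristic. -/
lemma isCoprime_Ψ₃_Ψ₂Sq : IsCoprime W.Ψ₃ W.Ψ₂Sq := by
  have hΔ : W.Δ ≠ 0 := W.isUnit_Δ.ne_zero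
  have key : (C 48 * X ^ 2 + C (8 * W.b₂) * X + C (32 * W.b₄ - W.b₂ ^ 2)) * W.Ψ₃ +
      (C (-36) * X ^ 3 + C (-9 * W.b₂) * X ^ 2 + C (W.b₂ ^ 2 - 42 * W.b₄) * X +
        C (W.b₂ * W.b₄ - 27 * W.b₆)) * W.Ψ₂Sq = C W.Δ := by
    simp only [Ψ₃, Ψ₂Sq, Δ, b₂, b₄, b₆, b₈]
    simp only [map_add, map_sub, map_mul, map_neg, map_pow, map_ofNat]
    ring
  refine ⟨C W.Δ⁻¹ * (C 48 * X ^ 2 + C (8 * W.b₂) * X + C (32 * W.b₄ - W.b₂ ^ 2)),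
    C W.Δ⁻¹ * (C (-36) * X ^ 3 + C (-9 * W.b₂) * X ^ 2 + C (W.b₂ ^ 2 - 42 * W.b₄) * X +
        C (W.b₂ * W.b₄ - 27 * W.b₆)), ?_⟩
  rw [mul_assoc, mul_assoc, ← mul_add, key, ← C_mul, inv_mul_cancel₀ hΔ, C_1]

/-- Modulo `Ψ₂Sq` the division polynomials of odd index are, up to sign, powers of `Ψ₃`. -/
lemma isCoprime_preΨ'_Ψ₂Sq {n : ℕ} (hn : Odd n) : IsCoprime (W.preΨ' n) W.Ψ₂Sq := by
  induction n using Nat.strong_induction_on with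
  | _ n ih =>
    obtain ⟨k, rfl⟩ := hn
    match k with
    | 0 => simpa using isCoprime_one_left
    | 1 => simpa using W.isCoprime_Ψ₃_Ψ₂Sq
    | m + 2 =>
      rw [preΨ'_odd]
      rcases m.even_or_odd with hm | hm
      · rw [if_pos hm, if_pos hm, mul_one]
        have h := ((ih (m + 1) (by omega) hm.add_one).mul_left
          ((ih (m + 3) (by omega) (by simp [hm, parity_simps])).pow_left (m := 3))).neg_left
        rw [sub_eq_neg_add, pow_two W.Ψ₂Sq, ← mul_assoc, mul_comm _ W.Ψ₂Sq]
        exact h.add_mul_left_left _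
      · rw [if_neg (Nat.not_even_iff_odd.2 hm), if_neg (Nat.not_even_iff_odd.2 hm), mul_one]
        have h := (ih (m + 4) (by omega) (by simp [hm, parity_simps])).mul_left
          ((ih (m + 2) (by omega) (by simp [hm, parity_simps])).pow_left (m := 3))
        rw [sub_eq_add_neg, pow_two W.Ψ₂Sq, ← mul_assoc, mul_comm _ W.Ψ₂Sq, ← mul_neg]
        exact h.add_mul_left_left _

/-- Where the leading coefficient `n` vanishes, the characteristic is odd, and `0` is not coprime to
the cubic `Ψ₂Sq`. -/
lemma preΨ'_ne_zero_of_odd {n : ℕ} (hn : Odd n) : W.preΨ' n ≠ 0 := by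
  by_cases h4 : (4 : K) = 0
  · apply W.preΨ'_ne_zero
    intro h0
    have hcop : IsCoprime (n : ℤ) (4 : ℤ) := by
      have : Nat.Coprime n 4 := Nat.Coprime.pow_right 2 hn.coprime_two_right
      exact_mod_cast this.isCoprime
    obtain ⟨a, b, hab⟩ := hcop
    have := congrArg (Int.cast : ℤ → K) hab
    push_cast at this
    simp [h0, h4] at this
  · intro h0
    have h := W.isCoprime_preΨ'_Ψ₂Sq hn
    rw [h0, isCoprime_zero_left] at h
    exact (natDegree_pos_iff_degree_pos.1 (W.natDegree_Ψ₂Sq_pos h4)).ne'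
      (degree_eq_zero_of_isUnit h)

lemma Ψ₂Sq_ne_zero_of_isElliptic : W.Ψ₂Sq ≠ 0 := by
  intro h0
  have h2 : W.b₂ = 0 := by
    simpa [Ψ₂Sq, coeff_X, coeff_C] using congrArg (fun p => coeff p 2) h0
  have h6 : W.b₆ = 0 := by
    simpa [Ψ₂Sq, coeff_X, coeff_C] using congrArg (fun p => coeff p 0) h0
  have h4 : (4 : K) = 0 := by
    simpa using congrArg (fun p => coeff p 3) h0
  apply W.isUnit_Δ.ne_zero
  rw [Δ, h2, h6]
  linear_combination (-2 * W.b₄ ^ 3) * h4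

end Nonvanishing

namespace Affine.Point

variable {K : Type*} [Field K] (W : WeierstrassCurve K)

instance finite_of_finite [Finite K] : Finite W.toAffine.Point := by
  have : Finite {xy : K × K // W.toAffine.Nonsingular xy.1 xy.2} := inferInstance
  exact Finite.of_equiv (Option _) W.toAffine.nonsingularPointEquiv.symm

/-- The `ℓ`-torsion of an elliptic curve has at most `ℓ ^ 2` rational points, also when `ℓ` is the
characteristic. -/
lemma card_torsion_le [Finite K] [DecidableEq K] [W.IsElliptic] {l : ℕ} (hl : l.Prime) :
    Nat.card {P : W.toAffine.Point // l • P = 0} ≤ l ^ 2 := by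
  classical
  have := Fintype.ofFinite W.toAffine.Point
  rw [Nat.card_eq_fintype_card, Fintype.card_subtype]
  set T := Finset.univ.filter fun P : W.toAffine.Point => l • P = 0 with hT
  have h0 : (0 : W.toAffine.Point) ∈ T := by simp [hT]
  have hmem : ∀ P ∈ T.erase 0, P ≠ 0 ∧ addOrderOf P = l := by
    intro P hP
    simp only [hT, Finset.mem_erase, Finset.mem_filter, Finset.mem_univ, true_and] at hP
    exact ⟨hP.1, have := Fact.mk hl; addOrderOf_eq_prime hP.2 hP.1⟩
  have hcard := Finset.card_erase_add_one h0
  rcases hl.eq_two_or_odd' with rfl | hodd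
  · have hinj : Set.InjOn xCoord (T.erase 0 : Set W.toAffine.Point) := by
      intro P hP Q hQ hPQ
      obtain ⟨hP0, -⟩ := hmem P hP
      obtain ⟨hQ0, hQ2⟩ := hmem Q hQ
      rcases (xCoord_eq_iff hP0 hQ0).1 hPQ with h | h
      · exact h
      · rw [h, neg_eq_iff_add_eq_zero, ← two_nsmul, ← hQ2, addOrderOf_nsmul_eq_zero]
    have hle : ((T.erase 0).image xCoord).card ≤ W.Ψ₂Sq.natDegree := by
      refine (Finset.card_le_card (t := W.Ψ₂Sq.roots.toFinset) ?_).trans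
        ((Multiset.toFinset_card_le _).trans (card_roots' _))
      intro x hx
      obtain ⟨P, hP, rfl⟩ := Finset.mem_image.1 hx
      obtain ⟨hP0, hP2⟩ := hmem P hP
      rw [Multiset.mem_toFinset, mem_roots W.Ψ₂Sq_ne_zero_of_isElliptic, IsRoot.def, ← psiTwo_sq hP0,
        (psiTwo_eq_zero_iff P).2 (by rw [← hP2, addOrderOf_nsmul_eq_zero]), zero_pow two_ne_zero]
    rw [Finset.card_image_of_injOn hinj] at hle
    have := W.natDegree_Ψ₂Sq_le
    omega
  · have h3 : 3 ≤ l := by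
      have := hl.two_le
      obtain ⟨k, rfl⟩ := hodd
      omega
    have hle : ((T.erase 0).image xCoord).card ≤ (W.preΨ' l).natDegree := by
      refine (Finset.card_le_card (t := (W.preΨ' l).roots.toFinset) ?_).trans
        ((Multiset.toFinset_card_le _).trans (card_roots' _))
      intro x hx
      obtain ⟨P, hP, rfl⟩ := Finset.mem_image.1 hx
      obtain ⟨-, hPl⟩ := hmem P hP
      rw [Multiset.mem_toFinset, mem_roots (W.preΨ'_ne_zero_of_odd hodd), IsRoot.def]
      subst hPl
      exact P.eval_preΨ'_addOrderOf h3 hodd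
    have hfib : (T.erase 0).card ≤ 2 * ((T.erase 0).image xCoord).card := by
      refine Finset.card_le_mul_card_image _ 2 fun x hx => ?_
      obtain ⟨P, hP, rfl⟩ := Finset.mem_image.1 hx
      refine (Finset.card_le_card (t := {P, -P}) fun Q hQ => ?_).trans Finset.card_le_two
      rw [Finset.mem_filter] at hQ
      have := (xCoord_eq_iff (hmem Q hQ.1).1 (hmem P hP).1).1 hQ.2
      simpa using this
    have hdeg := W.natDegree_preΨ'_le l
    rw [if_neg (Nat.not_even_iff_odd.2 hodd)] at hdeg
    have : 0 < l ^ 2 := by positivity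
    omega

end Affine.Point

end WeierstrassCurve

/-! ### Finite abelian groups of rank at most two -/

namespace AddCommGroup

open Finset

/-- In a product of cyclic groups of prime power order, the number of nontrivial factors belonging
to the prime `l` is bounded by the rank of the `l`-torsion. -/
lemma card_filter_le_of_card_torsion_le {ι : Type*} [Fintype ι] {p e : ι → ℕ} {l k : ℕ}
    (hp : ∀ i, (p i).Prime) (hl : l.Prime)
    (h : Nat.card {x : (i : ι) → ZMod (p i ^ e i) // l • x = 0} ≤ l ^ k) :
    #{i | p i = l ∧ e i ≠ 0} ≤ k := by
  classical
  set S := ({i | p i = l ∧ e i ≠ 0} : Finset ι) with hS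
  have hS' : ∀ i ∈ S, p i = l ∧ e i ≠ 0 := by simp [hS]
  have (i : ι) : NeZero (p i ^ e i) := ⟨pow_ne_zero _ (hp i).ne_zero⟩
  let φ : (S → Fin l) → {x : (i : ι) → ZMod (p i ^ e i) // l • x = 0} := fun a =>
    ⟨fun i => if hi : i ∈ S then ((a ⟨i, hi⟩ * l ^ (e i - 1) : ℕ) : ZMod (p i ^ e i)) else 0, by
      ext i
      by_cases hi : i ∈ S
      · simp only [Pi.smul_apply, hi, dif_pos, Pi.zero_apply, nsmul_eq_mul, ← Nat.cast_mul]
        rw [ZMod.natCast_eq_zero_iff, (hS' i hi).1]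
        refine ⟨a ⟨i, hi⟩, ?_⟩
        conv_rhs => rw [← Nat.succ_pred_eq_of_ne_zero (hS' i hi).2, pow_succ]
        simp only [Nat.pred_eq_sub_one]
        ring
      · simp [hi]⟩
  have hφ : Function.Injective φ := by
    intro a b hab
    ext ⟨i, hi⟩
    have := congrFun (congrArg Subtype.val hab) i
    simp only [φ, hi, dif_pos] at this
    rw [ZMod.natCast_eq_natCast_iff, (hS' i hi).1] at this
    have hlt : ∀ c : Fin l, (c : ℕ) * l ^ (e i - 1) < l ^ e i := by
      intro c
      conv_rhs => rw [← Nat.succ_pred_eq_of_ne_zero (hS' i hi).2, pow_succ']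
      exact Nat.mul_lt_mul_of_pos_right c.2 (pow_pos hl.pos _)
    exact Nat.eq_of_mul_eq_mul_right (pow_pos hl.pos _)
      (this.eq_of_lt_of_lt (hlt _) (hlt _))
  have hle := (Nat.card_le_card_of_injective φ hφ).trans h
  rw [Nat.card_eq_fintype_card, Fintype.card_fun, Fintype.card_fin, Fintype.card_coe] at hle
  exact (Nat.pow_le_pow_iff_right hl.one_lt).1 hle

/-- A finite abelian group whose `l`-torsion has at most `l ^ 2` elements for every prime `l` is a
product of two cyclic groups, the order of one dividing the order of the other. -/
theorem exists_equiv_zmod_prod_zmod {G : Type*} [AddCommGroup G] [Finite G]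
    (h : ∀ l : ℕ, l.Prime → Nat.card {g : G // l • g = 0} ≤ l ^ 2) :
    ∃ r s : ℕ, 0 < r ∧ s ∣ r ∧ Nonempty (G ≃+ ZMod r × ZMod s) := by
  classical
  obtain ⟨ι, _, p, hp, e, ⟨f⟩⟩ := AddCommGroup.equiv_directSum_zmod_of_finite G
  replace f := f.trans (DirectSum.addEquivProd _)
  have hfib : ∀ l : ℕ, l.Prime → #{i | p i = l ∧ e i ≠ 0} ≤ 2 := fun l hl => by
    refine card_filter_le_of_card_torsion_le hp hl ((Nat.card_congr ?_).le.trans (h l hl))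
    exact (f.toEquiv.subtypeEquiv fun g => by
      rw [← map_eq_zero_iff f f.injective, map_nsmul]; rfl).symm
  -- For each prime that occurs, `m` picks a factor of largest exponent.
  have hmax : ∀ l : ℕ, (∃ i, p i = l) → ∃ i, p i = l ∧ ∀ j, p j = l → e j ≤ e i := by
    rintro l ⟨i, hi⟩
    obtain ⟨k, hk, hk'⟩ := exists_max_image ({j | p j = l} : Finset ι) e ⟨i, by simpa using hi⟩
    exact ⟨k, by simpa using hk, fun j hj => hk' j (by simpa using hj)⟩
  choose m hm hme using hmax
  let c : ι → ι := fun i => m (p i) ⟨i, rfl⟩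
  have hpc : ∀ i, p (c i) = p i := fun i => hm _ _
  have hec : ∀ i, e i ≤ e (c i) := fun i => hme _ _ i rfl
  have hcongr : ∀ i j, p i = p j → c i = c j := by
    have : ∀ l l' h h', l = l' → m l h = m l' h' := by rintro l _ h h' rfl; rfl
    exact fun i j hij => this _ _ _ _ hij
  let q : ι → ℕ := fun i => p i ^ e i
  have hJ : Pairwise (Function.onFun Nat.Coprime fun i : {i // c i = i} => q i) := by
    rintro ⟨i, hi⟩ ⟨j, hj⟩ hij
    apply Nat.Coprime.pow
    rw [Nat.coprime_primes (hp i) (hp j)]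
    intro hpij
    exact hij (Subtype.ext (hi.symm.trans ((hcongr i j hpij).trans hj)))
  have hJc : Pairwise (Function.onFun Nat.Coprime fun i : {i // ¬ c i = i} => q i) := by
    rintro ⟨i, hi⟩ ⟨j, hj⟩ hij
    simp only [Function.onFun, q]
    by_cases hei : e i = 0
    · simp [hei]
    by_cases hej : e j = 0
    · simp [hej]
    apply Nat.Coprime.pow
    rw [Nat.coprime_primes (hp i) (hp j)]
    intro hpij
    have hcard : #{i, j, c i} = 3 := by
      refine card_eq_three.2 ⟨i, j, c i, fun h => hij (Subtype.ext h), fun h => hi h.symm,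
        fun h => hj ?_, rfl⟩
      rw [← hcongr i j hpij, ← h]
    have hsub : ({i, j, c i} : Finset ι) ⊆ ({k | p k = p i ∧ e k ≠ 0} : Finset ι) := by
      intro k hk
      simp only [mem_insert, mem_singleton] at hk
      rw [mem_filter]
      refine ⟨mem_univ _, ?_⟩
      rcases hk with rfl | rfl | rfl
      · exact ⟨rfl, hei⟩
      · exact ⟨hpij.symm, hej⟩
      · exact ⟨hpc i, fun h => hei (Nat.le_zero.1 (h ▸ hec i))⟩
    have := (card_le_card hsub).trans (hfib _ (hp i))
    omega
  refine ⟨∏ i : {i // c i = i}, q i, ∏ i : {i // ¬ c i = i}, q i,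
    prod_pos fun i _ => pow_pos (hp i).pos _, ?_,
    ⟨f.trans ((RingEquiv.piEquivPiSubtypeProd (fun i => c i = i) fun i => ZMod (q i)).trans
      ((ZMod.prodEquivPi _ hJ).symm.prodCongr (ZMod.prodEquivPi _ hJc).symm)).toAddEquiv⟩⟩
  refine Fintype.prod_dvd_of_isRelPrime
    (fun i j hij => Nat.coprime_iff_isRelPrime.1 (hJc hij)) fun i => ?_
  have hcc : c (c i) = c i := hcongr _ _ (hpc i)
  refine dvd_trans ?_ (dvd_prod_of_mem (fun i : {i // c i = i} => q i)
    (mem_univ (⟨c i, hcc⟩ : {i // c i = i})))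
  simp only [q, hpc]
  exact pow_dvd_pow _ (hec i)

end AddCommGroup

namespace ZMod

lemma exists_injective_addMonoidHom {m n : ℕ} (h : m ∣ n) (hn : n ≠ 0) :
    ∃ f : ZMod m →+ ZMod n, Function.Injective f := by
  obtain ⟨k, rfl⟩ := h
  have hk : k ≠ 0 := right_ne_zero_of_mul hn
  refine ⟨ZMod.lift m ⟨zmultiplesHom _ (k : ZMod (m * k)), ?_⟩, ?_⟩
  · simp [← Nat.cast_mul]
  · rw [ZMod.lift_injective]
    intro a ha
    simp only [zmultiplesHom_apply, zsmul_eq_mul] at ha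
    rw [← Int.cast_natCast, ← Int.cast_mul, ZMod.intCast_zmod_eq_zero_iff_dvd] at ha
    rw [ZMod.intCast_zmod_eq_zero_iff_dvd]
    push_cast at ha
    exact Int.dvd_of_mul_dvd_mul_right (by exact_mod_cast hk) ha

lemma card_nsmul_eq_zero_le {m n : ℕ} (hn : n ≠ 0) :
    Nat.card {x : ZMod n // m • x = 0} ≤ m.gcd n := by
  classical
  have := NeZero.mk hn
  have hpos : 0 < m.gcd n := Nat.gcd_pos_of_pos_right _ (Nat.pos_of_ne_zero hn)
  refine le_trans ?_ (IsAddCyclic.card_nsmul_eq_zero_le (α := ZMod n) hpos)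
  rw [Nat.card_eq_fintype_card, Fintype.card_subtype]
  refine Finset.card_le_card fun x hx => ?_
  rw [Finset.mem_filter] at hx ⊢
  refine ⟨hx.1, ?_⟩
  rw [← addOrderOf_dvd_iff_nsmul_eq_zero] at hx ⊢
  refine Nat.dvd_gcd hx.2 ?_
  rw [addOrderOf_dvd_iff_nsmul_eq_zero]
  simp

/-- The invariant factors decide which products of two cyclic groups embed into each other. -/
theorem exists_injective_prod_iff {n₁ n₂ r s : ℕ} (hn₂ : n₂ ∣ n₁) (hn₁ : n₁ ≠ 0) (hs : s ∣ r)
    (hr : r ≠ 0) :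
    (∃ f : ZMod n₁ × ZMod n₂ →+ ZMod r × ZMod s, Function.Injective f) ↔ n₁ ∣ r ∧ n₂ ∣ s := by
  have hs0 : s ≠ 0 := ne_zero_of_dvd_ne_zero hr hs
  have hn0 : n₂ ≠ 0 := ne_zero_of_dvd_ne_zero hn₁ hn₂
  constructor
  · rintro ⟨f, hf⟩
    constructor
    · have h1 : r • ((1 : ZMod n₁), (0 : ZMod n₂)) = 0 := by
        apply hf
        rw [map_nsmul, map_zero]
        ext
        · simp
        · simp [(ZMod.natCast_eq_zero_iff r s).2 hs]
      simpa [ZMod.natCast_eq_zero_iff] using congrArg Prod.fst h1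
    · obtain ⟨i, hi⟩ := exists_injective_addMonoidHom hn₂ hn₁
      have hkill : ∀ x : ZMod n₂ × ZMod n₂, n₂ • f (i x.1, x.2) = 0 := by
        intro x
        have hx : n₂ • (i x.1, x.2) = 0 := by
          rw [Prod.smul_mk, ← map_nsmul]
          simp
        rw [← map_nsmul, hx, map_zero]
      let φ : ZMod n₂ × ZMod n₂ → {x : ZMod r // n₂ • x = 0} × {x : ZMod s // n₂ • x = 0} :=
        fun x => (⟨(f (i x.1, x.2)).1, congrArg Prod.fst (hkill x)⟩,
          ⟨(f (i x.1, x.2)).2, congrArg Prod.snd (hkill x)⟩)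
      have hφ : Function.Injective φ := by
        intro x y hxy
        simp only [φ, Prod.mk.injEq, Subtype.mk.injEq] at hxy
        have := hf (Prod.ext hxy.1 hxy.2)
        simp only [Prod.mk.injEq] at this
        exact Prod.ext (hi this.1) this.2
      have := NeZero.mk hr
      have := NeZero.mk hs0
      have hle := Nat.card_le_card_of_injective φ hφ
      rw [Nat.card_prod, Nat.card_prod, Nat.card_zmod] at hle
      have h1 := (card_nsmul_eq_zero_le (m := n₂) hr).trans
        (Nat.gcd_le_left r (Nat.pos_of_ne_zero hn0))
      have h2 := hle.trans (Nat.mul_le_mul h1 (card_nsmul_eq_zero_le (m := n₂) hs0))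
      have h3 := Nat.le_of_mul_le_mul_left h2 (Nat.pos_of_ne_zero hn0)
      exact Nat.gcd_eq_left_iff_dvd.1
        (le_antisymm (Nat.gcd_le_left s (Nat.pos_of_ne_zero hn0)) h3)
  · rintro ⟨h1, h2⟩
    obtain ⟨f, hf⟩ := exists_injective_addMonoidHom h1 hr
    obtain ⟨g, hg⟩ := exists_injective_addMonoidHom h2 hs0
    exact ⟨f.prodMap g, hf.prodMap hg⟩

end ZMod

/-! ### Inclusion and exclusion over the primes dividing `n₁` -/

namespace CurveCount

open Finset

lemma factorization_prod_primes_pow {T : Finset ℕ} (hT : ∀ l ∈ T, l.Prime) (f : ℕ → ℕ) (l : ℕ) :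
    (∏ p ∈ T, p ^ f p).factorization l = if l ∈ T then f l else 0 := by
  rw [Nat.factorization_prod fun p hp => pow_ne_zero _ (hT p hp).ne_zero, Finsupp.finsetSum_apply,
    sum_congr rfl fun p hp => by rw [(hT p hp).factorization_pow, Finsupp.single_apply]]
  simp

/-- A full divisor of `n` is determined by its set of prime factors, which is arbitrary. -/
lemma sum_fullDivisors {M : Type*} [AddCommMonoid M] {n : ℕ} (hn : n ≠ 0) (g : Finset ℕ → M) :
    ∑ d ∈ fullDivisors n, g d.primeFactors = ∑ T ∈ n.primeFactors.powerset.erase ∅, g T := by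
  have hT : ∀ T ∈ n.primeFactors.powerset.erase ∅, ∀ l ∈ T, l.Prime := fun T hT l hl =>
    Nat.prime_of_mem_primeFactors (mem_powerset.1 (mem_erase.1 hT).2 hl)
  have hpf : ∀ T ∈ n.primeFactors.powerset.erase ∅,
      (∏ p ∈ T, p ^ n.factorization p).primeFactors = T := by
    intro T hT'
    ext l
    rw [← Nat.support_factorization, Finsupp.mem_support_iff,
      factorization_prod_primes_pow (hT T hT')]
    have : l ∈ T → n.factorization l ≠ 0 := fun hl => by
      rw [← Finsupp.mem_support_iff, Nat.support_factorization]
      exact mem_powerset.1 (mem_erase.1 hT').2 hl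
    by_cases hl : l ∈ T <;> simp [hl]
    simpa using this hl
  refine sum_nbij' Nat.primeFactors (fun T => ∏ p ∈ T, p ^ n.factorization p) ?_ ?_ ?_ hpf
    fun _ _ => rfl
  · intro d hd
    obtain ⟨h1, h2⟩ := (mem_fullDivisors hn).1 hd
    rw [mem_erase, mem_powerset]
    refine ⟨?_, Nat.primeFactors_mono (h1.dvd hn) hn⟩
    rw [Ne, Nat.primeFactors_eq_empty]
    omega
  · intro T hT'
    have hpos : 0 < ∏ p ∈ T, p ^ n.factorization p := prod_pos fun p hp => pow_pos (hT T hT' p hp).pos _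
    rw [mem_fullDivisors hn]
    refine ⟨⟨hpos, fun l hl hld => ?_⟩, ?_⟩
    · rw [factorization_prod_primes_pow (hT T hT'), if_pos]
      rw [← hpf T hT']
      exact Nat.mem_primeFactors.2 ⟨hl, hld, hpos.ne'⟩
    · by_contra hlt
      have h1 : ∏ p ∈ T, p ^ n.factorization p = 1 := by omega
      have := hpf T hT'
      rw [h1, Nat.primeFactors_one] at this
      exact (mem_erase.1 hT').1 this.symm
  · intro d hd
    obtain ⟨h1, h2⟩ := (mem_fullDivisors hn).1 hd
    conv_rhs => rw [← Nat.prod_factorization_pow_eq_self h1.1.ne']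
    refine prod_congr (Nat.support_factorization d).symm fun p hp => ?_
    rw [h1.2 p (Nat.prime_of_mem_primeFactors hp) (Nat.dvd_of_mem_primeFactors hp)]

lemma sum_powerset_erase_empty_neg_one_pow (S : Finset ℕ) :
    ∑ T ∈ S.powerset.erase ∅, (-1 : ℝ) ^ #T = (if S = ∅ then 1 else 0) - 1 := by
  have h := congrArg (Int.cast : ℤ → ℝ) (sum_powerset_neg_one_pow_card (x := S))
  push_cast at h
  rw [← h, ← sum_erase_add _ _ (empty_mem_powerset S)]
  simp

section Arithmetic

variable {q : ℕ} {t : ℤ} {r s n₁ n₂ : ℕ}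

lemma D_prime_pow (hN : (q : ℤ) + 1 - t = (r * s : ℕ)) (h0 : r * s ≠ 0) {l : ℕ} (hl : l.Prime)
    (k : ℕ) : D q t (l ^ k) = if k ≤ (r * s).factorization l then 1 else 0 := by
  rw [D, hN]
  simp only [Int.natCast_dvd_natCast, hl.pow_dvd_iff_le_factorization h0]

lemma D_prime_pow_sub (hN : (q : ℤ) + 1 - t = (r * s : ℕ)) (h0 : r * s ≠ 0) {l : ℕ} (hl : l.Prime)
    {k : ℕ} (hk : 0 < k) :
    D q t (l ^ (k - 1)) - D q t (l ^ k) = if (r * s).factorization l + 1 = k then 1 else 0 := by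
  rw [D_prime_pow hN h0 hl, D_prime_pow hN h0 hl]
  split_ifs <;> first | omega | norm_num

/-- If `n₁ n₂ ∤ q + 1 - t`, the factor of the product at a prime witnessing this vanishes, whether or
not that prime divides `e`. -/
lemma DD_eq_zero (hN : (q : ℤ) + 1 - t = (r * s : ℕ)) (h0 : r * s ≠ 0) (hn₁ : n₁ ≠ 0)
    (hdvd : n₂ ∣ n₁) {e : ℕ} (he : e ≠ 0) (h : ¬ n₁ * n₂ ∣ r * s) : DD q n₁ n₂ t n₁ e = 0 := by
  have hn₂ : n₂ ≠ 0 := ne_zero_of_dvd_ne_zero hn₁ hdvd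
  have hn : n₁ * n₂ ≠ 0 := mul_ne_zero hn₁ hn₂
  rw [← Nat.factorization_le_iff_dvd hn h0, Finsupp.le_def] at h
  push Not at h
  obtain ⟨l, hlt⟩ := h
  have hmem : l ∈ (n₁ * n₂).primeFactors := by
    rw [← Nat.support_factorization, Finsupp.mem_support_iff]
    omega
  have hl := Nat.prime_of_mem_primeFactors hmem
  rw [Nat.primeFactors_mul hn₁ hn₂,
    union_eq_left.2 (Nat.primeFactors_mono hdvd hn₁)] at hmem
  refine prod_eq_zero hmem ?_
  split_ifs with hle
  · have := hl.factorization_pos_of_dvd he hle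
    rw [Nat.factorization_mul hn he, Finsupp.add_apply, D_prime_pow_sub hN h0 hl (by omega),
      if_neg (by omega)]
  · rw [D_prime_pow hN h0 hl, if_neg (by omega)]

/-- Once `n₁ n₂ ∣ q + 1 - t`, only the primes dividing `e` impose a condition. -/
lemma DD_eq_ite (hN : (q : ℤ) + 1 - t = (r * s : ℕ)) (h0 : r * s ≠ 0) (hn : n₁ * n₂ ≠ 0)
    {e : ℕ} (he : e ≠ 0) (h : n₁ * n₂ ∣ r * s) :
    DD q n₁ n₂ t n₁ e =
      if ∀ l ∈ n₁.primeFactors, l ∣ e →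
        (r * s).factorization l + 1 = (n₁ * n₂).factorization l + e.factorization l
      then 1 else 0 := by
  rw [DD, ← prod_boole]
  refine prod_congr rfl fun l hl => ?_
  replace hl := Nat.prime_of_mem_primeFactors hl
  split_ifs with hle hk hk
  · rw [Nat.factorization_mul hn he, Finsupp.add_apply, ← hk hle, D_prime_pow_sub hN h0 hl (by omega),
      if_pos rfl]
  · have := hl.factorization_pos_of_dvd he hle
    rw [Nat.factorization_mul hn he, Finsupp.add_apply, D_prime_pow_sub hN h0 hl (by omega),
      if_neg fun h => hk fun _ => h]
  · rw [D_prime_pow hN h0 hl, if_pos]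
    exact (Nat.factorization_le_iff_dvd hn h0).2 h l
  · exact absurd (fun h => absurd h hle) hk

/-- The primes at which `n₁` fails to divide the larger invariant factor `r`. -/
def badPrimes (n₁ r : ℕ) : Finset ℕ := {l ∈ n₁.primeFactors | r.factorization l < n₁.factorization l}

lemma badPrimes_eq_empty_iff (hn₁ : n₁ ≠ 0) (hr : r ≠ 0) : badPrimes n₁ r = ∅ ↔ n₁ ∣ r := by
  rw [badPrimes, filter_eq_empty_iff, ← Nat.factorization_le_iff_dvd hn₁ hr]
  constructor
  · intro h l
    by_cases hl : l ∈ n₁.primeFactors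
    · exact not_lt.1 (h hl)
    · rw [← Nat.support_factorization, Finsupp.notMem_support_iff] at hl
      omega
  · exact fun h l _ => not_lt.2 (h l)

/-- For given `d` the conditions on `e` determine its valuations, as
`v(e) = v(rs) + 1 - v(n₁ n₂)`, and the resulting `e` is admissible exactly when `r` is not divisible
by the full power of `l` in `n₁`, for each prime `l ∣ d`. -/
lemma sum_precSet (hN : (q : ℤ) + 1 - t = (r * s : ℕ)) (h0 : r * s ≠ 0) (hs : s ∣ r)
    (hn₁ : n₁ ≠ 0) (hdvd : n₂ ∣ n₁) (hn₂s : n₂ ∣ s) (h : n₁ * n₂ ∣ r * s) {d : ℕ}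
    (hd : d ∈ fullDivisors n₁) :
    (∑ e ∈ precSet n₁ n₂ d, (if n₂ * e ∣ s then 1 else 0) * DD q n₁ n₂ t n₁ e) =
      if d.primeFactors ⊆ badPrimes n₁ r then 1 else 0 := by
  have hn₂ : n₂ ≠ 0 := ne_zero_of_dvd_ne_zero hn₁ hdvd
  have hn : n₁ * n₂ ≠ 0 := mul_ne_zero hn₁ hn₂
  have hr : r ≠ 0 := left_ne_zero_of_mul h0
  have hs0 : s ≠ 0 := right_ne_zero_of_mul h0
  obtain ⟨hfull, -⟩ := (mem_fullDivisors hn₁).1 hd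
  have hdn : d.primeFactors ⊆ n₁.primeFactors := Nat.primeFactors_mono (hfull.dvd hn₁) hn₁
  have hv : ∀ l, n₁.factorization l + n₂.factorization l ≤
      r.factorization l + s.factorization l := by
    intro l
    have := (Nat.factorization_le_iff_dvd hn h0).2 h l
    rwa [Nat.factorization_mul hn₁ hn₂, Nat.factorization_mul hr hs0] at this
  have hsr : ∀ l, s.factorization l ≤ r.factorization l :=
    (Nat.factorization_le_iff_dvd hs0 hr).2 hs
  have hn₂s' : ∀ l, n₂.factorization l ≤ s.factorization l :=
    (Nat.factorization_le_iff_dvd hn₂ hs0).2 hn₂s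
  have hdiv : ∀ l, (n₁ / n₂).factorization l = n₁.factorization l - n₂.factorization l := by
    intro l
    rw [Nat.factorization_div hdvd, Finsupp.tsub_apply]
  let f : ℕ → ℕ := fun l => r.factorization l + s.factorization l + 1 -
    (n₁.factorization l + n₂.factorization l)
  have hprime : ∀ l ∈ d.primeFactors, l.Prime := fun l hl => Nat.prime_of_mem_primeFactors hl
  have hterm : ∀ e ∈ precSet n₁ n₂ d, ((if n₂ * e ∣ s then 1 else 0) * DD q n₁ n₂ t n₁ e : ℝ) =
      if d.primeFactors ⊆ badPrimes n₁ r ∧ e = ∏ p ∈ d.primeFactors, p ^ f p then 1 else 0 := by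
    intro e he
    have hprec := (mem_precSet hn₁ hdvd).1 he
    have he0 : e ≠ 0 := hprec.1.ne'
    have hde : ∀ l, l ∈ d.primeFactors ↔ l.Prime ∧ l ∣ e := by
      intro l
      rw [Nat.mem_primeFactors]
      have h0 := hfull.1.ne'
      constructor
      · exact fun h => ⟨h.1, (hprec.2.1 l h.1).2 h.2.1⟩
      · exact fun h => ⟨h.1, (hprec.2.1 l h.1).1 h.2, h0⟩
    rw [DD_eq_ite hN h0 hn he0 h, ite_zero_mul_ite_zero, one_mul]
    refine if_congr ?_ rfl rfl
    rw [← Nat.factorization_le_iff_dvd (mul_ne_zero hn₂ he0) hs0, Nat.factorization_mul hn₂ he0,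
      Nat.factorization_mul hn₁ hn₂, Nat.factorization_mul hr hs0]
    simp only [Finsupp.add_apply, Finsupp.le_def]
    constructor
    · rintro ⟨h1, h2⟩
      have h3 : ∀ l ∈ d.primeFactors, e.factorization l = f l := by
        intro l hl
        have := h2 l (hdn hl) ((hde l).1 hl).2
        simp only [f]
        omega
      constructor
      · intro l hl
        rw [badPrimes, mem_filter]
        refine ⟨hdn hl, ?_⟩
        have := h2 l (hdn hl) ((hde l).1 hl).2
        have := h1 l
        omega
      · refine Nat.eq_of_factorization_eq he0
          (prod_ne_zero_iff.2 fun p hp => pow_ne_zero _ (hprime p hp).ne_zero) fun l => ?_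
        rw [factorization_prod_primes_pow hprime]
        split_ifs with hl
        · exact h3 l hl
        · rw [Nat.factorization_eq_zero_iff]
          rw [hde] at hl
          tauto
    · rintro ⟨h1, rfl⟩
      have h3 : ∀ l ∈ d.primeFactors, r.factorization l < n₁.factorization l := fun l hl =>
        (mem_filter.1 (h1 hl)).2
      constructor
      · intro l
        rw [factorization_prod_primes_pow hprime]
        split_ifs with hl
        · have := h3 l hl
          have := hv l
          simp only [f]
          omega
        · simpa using hn₂s' l
      · intro l hl hle
        have hl' := (hde l).2 ⟨Nat.prime_of_mem_primeFactors hl, hle⟩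
        rw [factorization_prod_primes_pow hprime, if_pos hl']
        have := hv l
        simp only [f]
        omega
  rw [sum_congr rfl hterm]
  split_ifs with hbad
  · have hmem : ∏ p ∈ d.primeFactors, p ^ f p ∈ precSet n₁ n₂ d := by
      have hne : ∏ p ∈ d.primeFactors, p ^ f p ≠ 0 :=
        prod_ne_zero_iff.2 fun p hp => pow_ne_zero _ (hprime p hp).ne_zero
      rw [mem_precSet hn₁ hdvd]
      refine ⟨Nat.pos_of_ne_zero hne, fun l hl => ?_, fun l hl hld => ?_⟩
      · have hf : 0 < f l := by
          have := hv l
          simp only [f]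
          omega
        rw [hl.dvd_iff_one_le_factorization hne, factorization_prod_primes_pow hprime]
        have := hfull.1.ne'
        split_ifs with h1
        · exact iff_of_true hf (Nat.dvd_of_mem_primeFactors h1)
        · exact iff_of_false (by omega) fun h2 => h1 (Nat.mem_primeFactors.2 ⟨hl, h2, this⟩)
      · have h1 : l ∈ d.primeFactors := Nat.mem_primeFactors.2 ⟨hl, hld, hfull.1.ne'⟩
        have := (mem_filter.1 (hbad h1)).2
        have := hsr l
        have := hv l
        rw [factorization_prod_primes_pow hprime, if_pos h1, hdiv]
        simp only [f]
        omega
    rw [sum_eq_single_of_mem _ hmem fun e _ he => if_neg fun h => he h.2, if_pos ⟨hbad, rfl⟩]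
  · exact sum_eq_zero fun e _ => if_neg fun h => hbad h.1

/-- The claimed identity for a single group `ℤ/r × ℤ/s` of order `q + 1 - t`. -/
theorem indicator_identity (hN : (q : ℤ) + 1 - t = (r * s : ℕ)) (hr : r ≠ 0) (hs : s ∣ r)
    (hn₁ : n₁ ≠ 0) (hdvd : n₂ ∣ n₁) :
    (if n₁ ∣ r ∧ n₂ ∣ s then 1 else 0 : ℝ) =
      (if n₂ ∣ s then 1 else 0) * D q t (n₁ * n₂) +
        ∑ d ∈ fullDivisors n₁, ∑ e ∈ precSet n₁ n₂ d,
          lam d * (if n₂ * e ∣ s then 1 else 0) * DD q n₁ n₂ t n₁ e := by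
  have hn₂ : n₂ ≠ 0 := ne_zero_of_dvd_ne_zero hn₁ hdvd
  have h0 : r * s ≠ 0 := mul_ne_zero hr (ne_zero_of_dvd_ne_zero hr hs)
  have hpos : ∀ d, ∀ e ∈ precSet n₁ n₂ d, e ≠ 0 := fun d e he =>
    ((mem_precSet hn₁ hdvd).1 he).1.ne'
  have hD : D q t (n₁ * n₂) = if n₁ * n₂ ∣ r * s then 1 else 0 := by
    rw [D, hN]
    simp only [Int.natCast_dvd_natCast]
  by_cases hn₂s : n₂ ∣ s
  · by_cases h : n₁ * n₂ ∣ r * s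
    · have hsum : ∑ d ∈ fullDivisors n₁, ∑ e ∈ precSet n₁ n₂ d,
          lam d * (if n₂ * e ∣ s then 1 else 0) * DD q n₁ n₂ t n₁ e =
          (if badPrimes n₁ r = ∅ then 1 else 0) - 1 := by
        rw [← sum_powerset_erase_empty_neg_one_pow]
        calc _ = ∑ d ∈ fullDivisors n₁, (-1 : ℝ) ^ #d.primeFactors *
              (if d.primeFactors ⊆ badPrimes n₁ r then 1 else 0) := by
              refine sum_congr rfl fun d hd => ?_
              simp only [mul_assoc, ← mul_sum, sum_precSet hN h0 hs hn₁ hdvd hn₂s h hd, lam]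
          _ = _ := by
              rw [sum_fullDivisors hn₁ fun T => (-1 : ℝ) ^ #T * if T ⊆ badPrimes n₁ r then 1 else 0]
              simp only [mul_ite, mul_one, mul_zero]
              rw [← sum_filter]
              refine sum_congr ?_ fun _ _ => rfl
              ext T
              have : badPrimes n₁ r ⊆ n₁.primeFactors := filter_subset _ _
              simp only [mem_filter, mem_erase, mem_powerset]
              constructor
              · exact fun h => ⟨h.1.1, h.2⟩
              · exact fun h => ⟨⟨h.1, h.2.trans this⟩, h.2⟩
      rw [hsum, hD, if_pos hn₂s, if_pos h]
      simp only [badPrimes_eq_empty_iff hn₁ hr, hn₂s, and_true]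
      ring
    · rw [hD, if_neg h, if_neg fun h' => h (mul_dvd_mul h'.1 h'.2), mul_zero, zero_add, eq_comm]
      refine sum_eq_zero fun d _ => sum_eq_zero fun e he => ?_
      rw [DD_eq_zero hN h0 hn₁ hdvd (hpos d e he) h, mul_zero]
  · rw [if_neg fun h' => hn₂s h'.2, if_neg hn₂s, zero_mul, zero_add, eq_comm]
    refine sum_eq_zero fun d _ => sum_eq_zero fun e he => ?_
    rw [if_neg fun h' => hn₂s ((dvd_mul_right _ _).trans h'), mul_zero, zero_mul]

end Arithmetic

/-! ### Summation over the curves -/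

section Curves

variable {F : Type*} [Field F] [Finite F] [DecidableEq F]

/-- The group of rational points is `ℤ/r × ℤ/s` with `s ∣ r`; its order gives the trace, and its
invariant factors decide which groups `ℤ/m × ℤ/n` embed. -/
lemma exists_point_equiv (c : IsoClass F) :
    ∃ r s : ℕ, r ≠ 0 ∧ s ∣ r ∧ (Nat.card F : ℤ) + 1 - trace c = (r * s : ℕ) ∧
      ∀ m n : ℕ, m ≠ 0 → n ∣ m → (Embeds (ZMod m × ZMod n) c ↔ m ∣ r ∧ n ∣ s) := by
  have : (model c).IsElliptic := (Quotient.out c).2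
  obtain ⟨r, s, hr, hs, ⟨g⟩⟩ := AddCommGroup.exists_equiv_zmod_prod_zmod fun l hl =>
    WeierstrassCurve.Affine.Point.card_torsion_le (model c) hl
  refine ⟨r, s, hr.ne', hs, ?_, fun m n hm hn => ?_⟩
  · rw [trace, Nat.card_congr g.toEquiv, Nat.card_prod, Nat.card_zmod, Nat.card_zmod]
    ring
  · rw [← ZMod.exists_injective_prod_iff hn hm hs hr.ne']
    constructor
    · rintro ⟨f, hf⟩
      exact ⟨g.toAddMonoidHom.comp f, g.injective.comp hf⟩
    · rintro ⟨f, hf⟩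
      exact ⟨g.symm.toAddMonoidHom.comp f, g.symm.injective.comp hf⟩

open Classical in
lemma probCurves_eq_sum (m n : ℕ) (t : ℤ) :
    probCurves F m n t = ∑ c : IsoClass F, 1 / ((Nat.card F : ℝ) * (autCard c : ℝ)) *
      if c ∈ curves F (ZMod m × ZMod n) t then 1 else 0 := by
  simp only [probCurves, prob, mul_ite, mul_one, mul_zero]

end Curves

end CurveCount

open CurveCount in
theorem proposition3p5 {F : Type*} [Field F] [Finite F] [DecidableEq F]
    (n₁ n₂ : ℕ) (hn₁ : 0 < n₁) (hdvd : n₂ ∣ n₁) (t : ℤ) :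
    CurveCount.probCurves F n₁ n₂ t =
      CurveCount.probCurves F n₂ n₂ t * CurveCount.D (Nat.card F) t (n₁ * n₂) +
        ∑ d ∈ CurveCount.fullDivisors n₁, ∑ e ∈ CurveCount.precSet n₁ n₂ d,
          CurveCount.lam d * CurveCount.probCurves F (n₂ * e) (n₂ * e) t *
            CurveCount.DD (Nat.card F) n₁ n₂ t n₁ e := by
  classical
  have hn₂ : n₂ ≠ 0 := ne_zero_of_dvd_ne_zero hn₁.ne' hdvd
  set w : IsoClass F → ℝ := fun c => 1 / ((Nat.card F : ℝ) * (autCard c : ℝ)) with hw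
  set I : ℕ → ℕ → IsoClass F → ℝ := fun m n c =>
    if c ∈ curves F (ZMod m × ZMod n) t then 1 else 0 with hI
  have hprob : ∀ m n : ℕ, probCurves F m n t = ∑ c, w c * I m n c := fun m n =>
    probCurves_eq_sum m n t
  have hpoint : ∀ c, I n₁ n₂ c = I n₂ n₂ c * D (Nat.card F) t (n₁ * n₂) +
      ∑ d ∈ fullDivisors n₁, ∑ e ∈ precSet n₁ n₂ d,
        lam d * I (n₂ * e) (n₂ * e) c * DD (Nat.card F) n₁ n₂ t n₁ e := by
    intro c
    by_cases ht : trace c = t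
    · obtain ⟨r, s, hr, hs, hN, hemb⟩ := exists_point_equiv c
      rw [ht] at hN
      have hdiag : ∀ n, n ≠ 0 → I n n c = if n ∣ s then 1 else 0 := by
        intro n hn
        simp only [hI, curves, Set.mem_ofPred_eq, ht, and_true, hemb n n hn dvd_rfl]
        exact if_congr ⟨fun h => h.2, fun h => ⟨h.trans hs, h⟩⟩ rfl rfl
      have h₁ : I n₁ n₂ c = if n₁ ∣ r ∧ n₂ ∣ s then 1 else 0 := by
        simp only [hI, curves, Set.mem_ofPred_eq, ht, and_true, hemb n₁ n₂ hn₁.ne' hdvd]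
      rw [h₁, hdiag n₂ hn₂, indicator_identity hN hr hs hn₁.ne' hdvd]
      congr 1
      refine Finset.sum_congr rfl fun d _ => Finset.sum_congr rfl fun e he => ?_
      rw [hdiag]
      exact mul_ne_zero hn₂ ((mem_precSet hn₁.ne' hdvd).1 he).1.ne'
    · simp [hI, curves, ht]
  simp only [hprob]
  simp only [hpoint, mul_add, Finset.sum_add_distrib, Finset.sum_mul, Finset.mul_sum]
  congr 1
  · exact Finset.sum_congr rfl fun c _ => by ring
  · rw [Finset.sum_comm]
    refine Finset.sum_congr rfl fun d _ => ?_
    rw [Finset.sum_comm]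
    exact Finset.sum_congr rfl fun e _ => Finset.sum_congr rfl fun c _ => by ring
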